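/- Let $m,n$ be positive integers with $m\le n$. The Multiple Hook Removing Game (MHRG) on the $m\times n$ rectangle $Y_{m,n}=\{(i,j): 1\le i\le m,\ 1\le j\le n\}$ is the following impartial game in normal play. Positions are Young diagrams contained in $Y_{m,n}$; the starting position is $Y_{m,n}$; the box $(i,j)$ carries the number $\min(j-i+m,\ i-j+n)$. For a Young diagram $Y$ and a box $(i,j)\in Y$, the hook at $(i,j)$ consists of $(i,j)$, the boxes $(i,j')\in Y$ with $j'>j$ and the boxes $(i',j)\in Y$ with $i'>i$; $\mathcal H_Y(i,j)$ is the multiset of the numbers on this hook; and $Y\langle i,j\rangle$ is the Young diagram obtained by deleting the hook and moving every box $(i',j')\in Y$ with $i'>i$ and $j'>j$ to $(i'-1,j'-1)$. A move from $Y\ne\emptyset$ chooses a box $(i,j)\in Y$ and replaces $Y$ by $Y\langle i,j\rangle$ if no box $(i',j')\in Y\langle i,j\rangle$ satisfies $\mathcal H_{Y\langle i,j\rangle}(i',j')=\mathcal H_Y(i,j)$, and by $(Y\langle i,j\rangle)\langle i',j'\rangle$ if there is such a box $(i',j')$ (there is at most one). The player who reaches $\emptyset$ wins. A position is a $\mathcal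 P$-position if the previous player (the one who has just moved) has a winning strategy. Let $\chi=1$ if $m+n$ is even and $\chi=0$ if $m+n$ is odd, let $c=(m+n-1+\chi)/2$, and let $d_i(q)=c-m+2+i+4q$ for integers $i$ and $q\ge 0$. Partitions are identified when they differ only by trailing zeros, and $\langle a,b\rangle$ denotes the partition $(a,b,0,0,\dots)$. For an integer $p\ge 0$ let $\mathcal D(p)=\{\langle 2q,2q\rangle : 0\le q\le p\}$; below, $q$ runs over integers. Let $\lambda$ be a partition with at most two nonzero parts whose Young diagram $Y_\lambda$ is reachable, i.e. occurs as a position of MHRG started from $Y_{m,n}$. Then $Y_\lambda$ is a $\mathcal P$-position of this game if and only if \[ \lambda\in \begin{cases} \mathcal D(p)\cup\{\langle d_1(q),d_0(q)\rangle,\ \langle d_2(q),d_1(q)\rangle : 0\le q\le (p-1)/2\} & \text{if } n-m=4p,\\ \mathcal D(p)\cup\{\langle d_2(q),d_1(q)\rangle,\ \langle d_3(q),d_2(q)\rangle : 0\le q\le (p-1)/2\} & \text{if } n-m=4p+1,\\ \mathcal D(p)\cup\{\langle d_0(q),d_{-1}(q)\rangle,\ \langle d_1(q),d_0(q)\rangle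 : 0\le q\le p/2\} & \text{if } n-m=4p+2,\\ \mathcal D(p)\cup\{\langle 2p+4,2p+2\rangle,\ \langle 2p+5,2p+4\rangle\}\cup\{\langle d_1(q),d_0(q)\rangle,\ \langle d_2(q),d_1(q)\rangle : 1\le q\le p/2\} & \text{if } n-m=4p+3, \end{cases} \] where $p\in\mathbb Z_{\ge 0}$. -/

import Mathlib

/-!
Multiple Hook Removing Game (MHRG). Boxes are indexed from `0`, as in Mathlib's `YoungDiagram`: the
box in row `i` and column `j` of the usual (1-indexed) convention is `(i - 1, j - 1)` here. The
unimodal numbering depends on `j - i` only, so its formula does not change.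
-/

namespace MHRG

/-- The rectangular Young diagram with `m` rows and `n` columns. -/
def rect (m n : ℕ) : YoungDiagram where
  cells := Finset.range m ×ˢ Finset.range n
  isLowerSet := by
    rintro ⟨a, b⟩ ⟨a', b'⟩ ⟨h1, h2⟩ h
    simp only [Finset.coe_product, Finset.coe_range, Set.mem_prod, Set.mem_Iio] at h ⊢
    exact ⟨lt_of_le_of_lt h1 h.1, lt_of_le_of_lt h2 h.2⟩

/-- The unimodal numbering `c (i, j) = min (j - i + m, i - j + n)`. -/
def numbering (m n : ℕ) (x : ℕ × ℕ) : ℤ :=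
  min ((x.2 : ℤ) - x.1 + m) ((x.1 : ℤ) - x.2 + n)

/-- The hook of `Y` at the box `x`: the box `x`, the boxes to its right in the same row, and the
boxes below it in the same column. -/
def hook (Y : YoungDiagram) (x : ℕ × ℕ) : Finset (ℕ × ℕ) :=
  Y.cells.filter fun y => y = x ∨ (y.1 = x.1 ∧ x.2 < y.2) ∨ (x.1 < y.1 ∧ y.2 = x.2)

/-- The numbering multiset of the hook of `Y` at the box `x`. -/
def hookNumbers (m n : ℕ) (Y : YoungDiagram) (x : ℕ × ℕ) : Multiset ℤ :=
  (hook Y x).val.map (numbering m n)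

/-- The Young diagram obtained from `Y` by removing the hook at `x` and filling the gap: boxes
strictly below and strictly to the right of `x` move one step up and one step to the left. -/
def removeHook (Y : YoungDiagram) (x : ℕ × ℕ) : YoungDiagram where
  cells := (Y.cells.filter fun y => y.1 < x.1 ∨ y.2 < x.2) ∪
    (Y.cells.filter fun y => x.1 < y.1 ∧ x.2 < y.2).image fun y => (y.1 - 1, y.2 - 1)
  isLowerSet := by
    rintro ⟨a, b⟩ ⟨a', b'⟩ ⟨h1, h2⟩ h
    simp only [Finset.coe_union, Finset.coe_filter, Finset.coe_image, Set.mem_union,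
      Set.mem_ofPred_eq, Set.mem_image, Prod.mk.injEq, Prod.exists, YoungDiagram.mem_cells]
      at h h1 h2 ⊢
    by_cases hx : a' < x.1 ∨ b' < x.2
    · refine Or.inl ⟨?_, hx⟩
      rcases h with ⟨h, -⟩ | ⟨u, v, ⟨h, -, -⟩, hu, hv⟩
      · exact Y.up_left_mem h1 h2 h
      · exact Y.up_left_mem (by omega) (by omega) h
    · refine Or.inr ⟨a' + 1, b' + 1, ⟨?_, by omega, by omega⟩, by omega, by omega⟩
      rcases h with ⟨h, h'⟩ | ⟨u, v, ⟨h, hu', hv'⟩, hu, hv⟩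
      · omega
      · exact Y.up_left_mem (by omega) (by omega) h

/-- `IsOption m n Y Z`: in MHRG with the unimodal numbering of the `m × n` rectangle, `Z` is an
option of `Y`. The player removes the hook of `Y` at a box `x`; if the resulting diagram has no hook
with the same numbering multiset, the move ends there, and otherwise that hook is removed as
well (there is never more than one such hook). -/
def IsOption (m n : ℕ) (Y Z : YoungDiagram) : Prop :=
  ∃ x ∈ Y,
    ((¬ ∃ y ∈ removeHook Y x, hookNumbers m n (removeHook Y x) y = hookNumbers m n Y x) ∧
      Z = removeHook Y x) ∨
    (∃ y ∈ removeHook Y x, hookNumbers m n (removeHook Y x) y = hookNumbers m n Y x ∧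
      Z = removeHook (removeHook Y x) y)

/-- The game positions of MHRG whose starting position is the `m × n` rectangle. -/
def positions (m n : ℕ) : Set YoungDiagram :=
  {Y | Relation.ReflTransGen (IsOption m n) (rect m n) Y}

/-- `IsPPosition opt G`: in the impartial game under normal play whose options are given by `opt`,
the previous player wins from `G`, that is, has a reply to each move of the next player which leads
again to a position of this kind (and the game ends after finitely many moves). -/
inductive IsPPosition {α : Type*} (opt : α → α → Prop) : α → Prop
  | intro (G : α) (reply : ∀ H, opt G H → α)
      (legal : ∀ H (h : opt G H), opt H (reply H h))
      (win : ∀ H (h : opt G H), IsPPosition opt (reply H h)) : IsPPosition opt G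

/-- The partition of a Young diagram, continued by zeros (`shape Y 0` is the first part). -/
def shape (Y : YoungDiagram) : ℕ → ℤ := fun i => (Y.rowLen i : ℤ)

/-- The partition `(a, b, 0, 0, …)`. -/
def twoRows (a b : ℤ) : ℕ → ℤ := fun i => if i = 0 then a else if i = 1 then b else 0

/-- `χ` is `1` if `m + n` is even and `0` if `m + n` is odd. -/
def chi (m n : ℕ) : ℤ := if Even (m + n) then 1 else 0

/-- `c = (m + n - 1 + χ) / 2`, the largest number in the unimodal numbering (the division is
exact). -/
def c (m n : ℕ) : ℤ := ((m : ℤ) + n - 1 + chi m n) / 2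

/-- `d_i (q) = c - m + 2 + i + 4 q`. -/
def d (m n : ℕ) (i : ℤ) (q : ℕ) : ℤ := c m n - m + 2 + i + 4 * q

/-- The set of the partitions `(2 q, 2 q)` with `0 ≤ q ≤ p`. -/
def evenPairs (p : ℕ) : Set (ℕ → ℤ) := {s | ∃ q : ℕ, q ≤ p ∧ s = twoRows (2 * q) (2 * q)}

end MHRG

/-! Encode a diagram by its Maya diagram: the beads `λ_i - i` in `ℤ`, the other integers being gaps.
Removing a hook moves one bead `u` down to a gap `w`, and the numbers on the hook are the values of
the unimodal numbering on the diagonals in `[w, u)`. The numbering is symmetric, so with `T = n - m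
+ 1` this multiset determines the interval up to the reflection of its endpoints under `z ↦ T - z`.
The rectangle has no two beads (possibly equal) that are mirror images, and options inherit this
property. Hence a move `u → w` is followed by `T - w → T - u` exactly when `T - w` is then a bead.

With at most two rows, the beads are all integers `≤ -2` and two more, `λ_2 - 1 < λ_1`, which
mirror-freeness confines to `[-1, T + 1]`. This is a game on pairs, and its P-positions are given by
an explicit kernel whose pairs are pairwise disjoint. So changing one element never leads from a
kernel pair to another, and a double move reflects the whole pair, which the differences and
positions of the kernel pairs rule out. Conversely, from any other admissible pair one can move to
the partner of one of the elements, except for some adjacent pairs `x, x + 1` above `T / 2`, which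
are reflected onto a low kernel pair or repaired by lowering `x`. -/

namespace MHRG

/-! ### Maya diagrams and hook removal -/

/-- The position `λ_i - i` of the `i`-th bead of the Maya diagram of `Y`. -/
def bead (Y : YoungDiagram) (i : ℕ) : ℤ := (Y.rowLen i : ℤ) - i

/-- The position `j + 1 - λ'_j` of the `j`-th gap of the Maya diagram of `Y`. -/
def gap (Y : YoungDiagram) (j : ℕ) : ℤ := (j : ℤ) + 1 - Y.colLen j

/-- The set of the beads of the Maya diagram of `Y`. -/
def beads (Y : YoungDiagram) : Set ℤ := Set.range (bead Y)

theorem mem_iff_gap_lt_bead (Y : YoungDiagram) (i j : ℕ) : (i, j) ∈ Y ↔ gap Y j < bead Y i := by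
  have h1 := Y.mem_iff_lt_rowLen (i := i) (j := j)
  have h2 := Y.mem_iff_lt_colLen (i := i) (j := j)
  unfold gap bead
  by_cases h : (i, j) ∈ Y
  · have := h1.1 h
    have := h2.1 h
    simp only [h, true_iff]
    omega
  · have := mt h1.2 h
    have := mt h2.2 h
    simp only [h, false_iff]
    omega

theorem bead_ne_gap (Y : YoungDiagram) (i j : ℕ) : bead Y i ≠ gap Y j := by
  have h1 := Y.mem_iff_lt_rowLen (i := i) (j := j)
  have h2 := Y.mem_iff_lt_colLen (i := i) (j := j)
  unfold gap bead
  by_cases h : (i, j) ∈ Y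
  · have := h1.1 h
    have := h2.1 h
    omega
  · have := mt h1.2 h
    have := mt h2.2 h
    omega

theorem gap_notMem_beads (Y : YoungDiagram) (j : ℕ) : gap Y j ∉ beads Y := by
  rintro ⟨i, hi⟩
  exact bead_ne_gap Y i j hi

theorem bead_strictAnti (Y : YoungDiagram) : StrictAnti (bead Y) := by
  refine strictAnti_nat_of_succ_lt fun i => ?_
  have := Y.rowLen_anti i (i + 1) (Nat.le_succ i)
  unfold bead
  push_cast
  omega

theorem rowLen_eq_of_forall {Y : YoungDiagram} {i r : ℕ} (h : ∀ j, (i, j) ∈ Y ↔ j < r) :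
    Y.rowLen i = r :=
  eq_of_forall_lt_iff fun j => by rw [← YoungDiagram.mem_iff_lt_rowLen, h]

theorem colLen_eq_of_forall {Y : YoungDiagram} {j r : ℕ} (h : ∀ i, (i, j) ∈ Y ↔ i < r) :
    Y.colLen j = r :=
  eq_of_forall_lt_iff fun i => by rw [← YoungDiagram.mem_iff_lt_colLen, h]

/-- If exactly `k` beads lie above `z`, the column `j` with `j + 1 - k = z` has length `k`. -/
theorem exists_gap_of_notMem_beads (Y : YoungDiagram) {z : ℤ} (hz : z ∉ beads Y) :
    ∃ j, gap Y j = z := by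
  classical
  have hex : ∃ i, bead Y i ≤ z := by
    -- Row lengths are at most the first one, so this bead is at most `-|z|`.
    refine ⟨Y.rowLen 0 + z.natAbs, ?_⟩
    have := Y.rowLen_anti 0 (Y.rowLen 0 + z.natAbs) (Nat.zero_le _)
    have := neg_abs_le z
    unfold bead
    push_cast
    omega
  have hlt : bead Y (Nat.find hex) < z :=
    lt_of_le_of_ne (Nat.find_spec hex) fun h => hz ⟨_, h⟩
  have hmin : ∀ i < Nat.find hex, z < bead Y i := fun i hi => not_le.1 (Nat.find_min hex hi)
  generalize Nat.find hex = k at hlt hmin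
  unfold bead at hlt hmin
  obtain ⟨j, hj⟩ : ∃ j : ℕ, (j : ℤ) = z + k - 1 := ⟨(z + k - 1).toNat, by omega⟩
  refine ⟨j, ?_⟩
  have hcol : Y.colLen j = k := by
    refine colLen_eq_of_forall fun i => ?_
    rw [YoungDiagram.mem_iff_lt_rowLen]
    constructor
    · intro h
      by_contra hik
      have := Y.rowLen_anti k i (by omega)
      omega
    · intro h
      have h1 := Y.rowLen_anti i (k - 1) (by omega)
      have h2 := hmin (k - 1) (by omega)
      omega
  unfold gap
  rw [hcol]
  omega

theorem mem_removeHook (Y : YoungDiagram) (i j a b : ℕ) :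
    (a, b) ∈ removeHook Y (i, j) ↔
      ((a, b) ∈ Y ∧ (a < i ∨ b < j)) ∨ ((a + 1, b + 1) ∈ Y ∧ i ≤ a ∧ j ≤ b) := by
  rw [← YoungDiagram.mem_cells]
  simp only [removeHook, Finset.mem_union, Finset.mem_filter, Finset.mem_image, Prod.exists,
    YoungDiagram.mem_cells, Prod.mk.injEq]
  refine or_congr Iff.rfl ⟨?_, ?_⟩
  · rintro ⟨u, v, ⟨h, hu, hv⟩, rfl, rfl⟩
    refine ⟨?_, by omega, by omega⟩
    rwa [Nat.sub_add_cancel (by omega), Nat.sub_add_cancel (by omega)]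
  · rintro ⟨h, hu, hv⟩
    exact ⟨a + 1, b + 1, ⟨h, by omega, by omega⟩, by omega, by omega⟩

theorem removeHook_le (Y : YoungDiagram) (x : ℕ × ℕ) : removeHook Y x ≤ Y := by
  rintro ⟨a, b⟩ h
  rcases (mem_removeHook Y x.1 x.2 a b).1 h with h | h
  · exact h.1
  · exact Y.up_left_mem (by omega) (by omega) h.1

theorem removeHook_lt {Y : YoungDiagram} {x : ℕ × ℕ} (hx : x ∈ Y) :
    (removeHook Y x).card < Y.card := by
  refine Finset.card_lt_card ((Finset.ssubset_iff_of_subset (removeHook_le Y x)).2 ?_)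
  refine ⟨(x.1, Y.rowLen x.1 - 1), ?_, ?_⟩
  · have := (YoungDiagram.mem_iff_lt_rowLen (i := x.1) (j := x.2)).1 hx
    exact YoungDiagram.mem_iff_lt_rowLen.2 (by omega)
  · have := (YoungDiagram.mem_iff_lt_rowLen (i := x.1) (j := x.2)).1 hx
    have h2 := Y.rowLen_anti x.1 (x.1 + 1) (by omega)
    intro h
    rcases (mem_removeHook Y x.1 x.2 _ _).1 h with h | h
    · omega
    · have := YoungDiagram.mem_iff_lt_rowLen.1 h.1
      omega

/-- Inside the hook each row is replaced by the next one less a box, and the last row by `j`. One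
row up and one box fewer leaves `λ_i - i` unchanged, so only one bead really moves. -/
theorem rowLen_removeHook {Y : YoungDiagram} {i j : ℕ} (h : (i, j) ∈ Y) (a : ℕ) :
    (removeHook Y (i, j)).rowLen a =
      if a < i ∨ Y.colLen j ≤ a then Y.rowLen a
      else if a + 1 = Y.colLen j then j else Y.rowLen (a + 1) - 1 := by
  have hi := YoungDiagram.mem_iff_lt_colLen.1 h
  have key : ∀ a, j < Y.rowLen a ↔ a < Y.colLen j := fun a => by
    rw [← YoungDiagram.mem_iff_lt_colLen, ← YoungDiagram.mem_iff_lt_rowLen]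
  have hanti := Y.rowLen_anti a (a + 1) (by omega)
  have k1 := key a
  have k2 := key (a + 1)
  refine rowLen_eq_of_forall fun b => ?_
  rw [mem_removeHook, YoungDiagram.mem_iff_lt_rowLen, YoungDiagram.mem_iff_lt_rowLen]
  split_ifs <;> omega

theorem mem_beads_removeHook {Y : YoungDiagram} {i j : ℕ} (h : (i, j) ∈ Y) (z : ℤ) :
    z ∈ beads (removeHook Y (i, j)) ↔ (z ∈ beads Y ∧ z ≠ bead Y i) ∨ z = gap Y j := by
  have hi := YoungDiagram.mem_iff_lt_colLen.1 h
  have key : ∀ a, j < Y.rowLen a ↔ a < Y.colLen j := fun a => by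
    rw [← YoungDiagram.mem_iff_lt_colLen, ← YoungDiagram.mem_iff_lt_rowLen]
  have hb : ∀ a, bead (removeHook Y (i, j)) a =
      if a < i ∨ Y.colLen j ≤ a then bead Y a
      else if a + 1 = Y.colLen j then gap Y j else bead Y (a + 1) := by
    intro a
    have k2 := key (a + 1)
    unfold bead gap
    rw [rowLen_removeHook h]
    split_ifs <;> push_cast <;> omega
  constructor
  · rintro ⟨a, rfl⟩
    rw [hb]
    split_ifs with h1 h2
    · exact Or.inl ⟨⟨a, rfl⟩, (bead_strictAnti Y).injective.ne (by omega)⟩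
    · exact Or.inr rfl
    · exact Or.inl ⟨⟨a + 1, rfl⟩, (bead_strictAnti Y).injective.ne (by omega)⟩
  · rintro (⟨⟨a, rfl⟩, hne⟩ | rfl)
    · have hai : a ≠ i := fun e => hne (by rw [e])
      by_cases h1 : a < i ∨ Y.colLen j ≤ a
      · exact ⟨a, by rw [hb, if_pos h1]⟩
      · refine ⟨a - 1, ?_⟩
        rw [hb, if_neg (by omega), if_neg (by omega), Nat.sub_add_cancel (by omega)]
    · exact ⟨Y.colLen j - 1, by rw [hb, if_neg (by omega), if_pos (by omega)]⟩

/-! ### Numbers on a hook and their reflection -/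

/-- The number of the boxes `(i, j)` with `j - i = k`. -/
def diagonalNumber (m n : ℕ) (k : ℤ) : ℤ := min (k + m) (n - k)

/-- The hook meets each diagonal from its lowest box to its rightmost box exactly once. -/
theorem hookNumbers_eq (m n : ℕ) {Y : YoungDiagram} {i j : ℕ} (h : (i, j) ∈ Y) :
    hookNumbers m n Y (i, j) =
      (Finset.Ico (gap Y j) (bead Y i)).val.map (diagonalNumber m n) := by
  have hi := YoungDiagram.mem_iff_lt_colLen.1 h
  have hj := YoungDiagram.mem_iff_lt_rowLen.1 h
  have himg : (hook Y (i, j)).image (fun y => (y.2 : ℤ) - y.1) =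
      Finset.Ico (gap Y j) (bead Y i) := by
    ext k
    simp only [hook, Finset.mem_image, Finset.mem_filter, Prod.exists, YoungDiagram.mem_cells,
      Finset.mem_Ico, Prod.mk.injEq, gap, bead]
    constructor
    · rintro ⟨a, b, ⟨hab, hh⟩, rfl⟩
      rcases hh with ⟨rfl, rfl⟩ | ⟨rfl, hlt⟩ | ⟨hlt, rfl⟩
      · omega
      · have := YoungDiagram.mem_iff_lt_rowLen.1 hab
        omega
      · have := YoungDiagram.mem_iff_lt_colLen.1 hab
        omega
    · rintro ⟨h1, h2⟩
      -- Diagonals from that of the corner onwards are met in the arm, the earlier ones in the leg.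
      by_cases hk : (j : ℤ) - i ≤ k
      · refine ⟨i, (k + i).toNat, ⟨YoungDiagram.mem_iff_lt_rowLen.2 (by omega), ?_⟩, by omega⟩
        omega
      · refine ⟨(j - k).toNat, j, ⟨YoungDiagram.mem_iff_lt_colLen.2 (by omega), ?_⟩, by omega⟩
        omega
  have hinj : Set.InjOn (fun y : ℕ × ℕ => (y.2 : ℤ) - y.1) (hook Y (i, j)) := by
    rintro ⟨a, b⟩ h1 ⟨a', b'⟩ h2 he
    simp only [hook, Finset.coe_filter, Set.mem_ofPred_eq, Prod.mk.injEq] at h1 h2 he ⊢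
    omega
  rw [← himg, Finset.image_val_of_injOn hinj, Multiset.map_map, hookNumbers]
  refine Multiset.map_congr rfl fun y _ => ?_
  simp only [numbering, diagonalNumber, Function.comp]
  congr 1
  omega

theorem map_diagonalNumber_reflect (m n : ℕ) (w u : ℤ) :
    (Finset.Ico ((n : ℤ) - m + 1 - u) (n - m + 1 - w)).val.map (diagonalNumber m n) =
      (Finset.Ico w u).val.map (diagonalNumber m n) := by
  have himg : (Finset.Ico w u).image (fun k => (n : ℤ) - m - k) =
      Finset.Ico ((n : ℤ) - m + 1 - u) (n - m + 1 - w) := by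
    ext k
    simp only [Finset.mem_image, Finset.mem_Ico]
    constructor
    · rintro ⟨a, ha, rfl⟩
      omega
    · intro h
      exact ⟨n - m - k, by omega, by omega⟩
  rw [← himg, Finset.image_val_of_injOn (fun a _ b _ (h : (n : ℤ) - m - a = n - m - b) => by omega),
    Multiset.map_map]
  refine Multiset.map_congr rfl fun k _ => ?_
  simp only [diagonalNumber, Function.comp]
  omega

/-- The cardinality gives the length of the interval. A unimodal function attains its minimum at an
end, so the minimum is `min (w + m) (n - u + 1)`; together with the length it leaves only the
interval and its reflection. -/
theorem eq_or_reflect_of_map_diagonalNumber_eq {m n : ℕ} {w u w' u' : ℤ} (h : w < u) (h' : w' < u')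
    (he : (Finset.Ico w u).val.map (diagonalNumber m n) =
      (Finset.Ico w' u').val.map (diagonalNumber m n)) :
    (w' = w ∧ u' = u) ∨ (w' = n - m + 1 - u ∧ u' = n - m + 1 - w) := by
  have hcard : u - w = u' - w' := by
    have := congrArg Multiset.card he
    simp only [Multiset.card_map, Finset.card_val, Int.card_Ico] at this
    omega
  have hle : ∀ {w u w' u' : ℤ}, w < u → w' < u' →
      (Finset.Ico w u).val.map (diagonalNumber m n) =
        (Finset.Ico w' u').val.map (diagonalNumber m n) →
      min (w + m) (n - u + 1) ≤ min (w' + m) (n - u' + 1) := by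
    intro w u w' u' h h' he
    have hbound : ∀ k ∈ (Finset.Ico w' u').val.map (diagonalNumber m n),
        min (w + m) (n - u + 1) ≤ k := by
      rw [← he]
      intro k hk
      obtain ⟨a, ha, rfl⟩ := Multiset.mem_map.1 hk
      have := Finset.mem_Ico.1 (Finset.mem_def.2 ha)
      unfold diagonalNumber
      omega
    have h1 := hbound _ (Multiset.mem_map_of_mem _
      (Finset.mem_def.1 (Finset.mem_Ico.2 ⟨le_refl w', h'⟩)))
    have h2 := hbound _ (Multiset.mem_map_of_mem _
      (Finset.mem_def.1 (Finset.mem_Ico.2 ⟨(by omega : w' ≤ u' - 1), by omega⟩)))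
    unfold diagonalNumber at h1 h2
    omega
  have h1 := hle h h' he
  have h2 := hle h' h he.symm
  omega

/-! ### Moves of the game as bead moves -/

/-- No two (possibly equal) elements of `B` are mirror images under `z ↦ T - z`. -/
def MirrorFree (T : ℤ) (B : Set ℤ) : Prop := ∀ x ∈ B, ∀ y ∈ B, x + y ≠ T

/-- The set obtained from `B` by moving the element `u` to `w`. -/
def moveBead (B : Set ℤ) (u w : ℤ) : Set ℤ := {z | (z ∈ B ∧ z ≠ u) ∨ z = w}

theorem beads_removeHook {Y : YoungDiagram} {i j : ℕ} (h : (i, j) ∈ Y) :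
    beads (removeHook Y (i, j)) = moveBead (beads Y) (bead Y i) (gap Y j) :=
  Set.ext fun z => mem_beads_removeHook h z

theorem exists_hook {Y : YoungDiagram} {u w : ℤ} (hu : u ∈ beads Y) (hw : w ∉ beads Y)
    (h : w < u) : ∃ i j, (i, j) ∈ Y ∧ bead Y i = u ∧ gap Y j = w := by
  obtain ⟨i, rfl⟩ := hu
  obtain ⟨j, rfl⟩ := exists_gap_of_notMem_beads Y hw
  exact ⟨i, j, (mem_iff_gap_lt_bead Y i j).2 h, rfl, rfl⟩

/-- Guarantees that the reflected move has a free target, so that it is the removal of a hook. -/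
theorem mirror_notMem_moveBead {T : ℤ} {B : Set ℤ} (hB : MirrorFree T B) {u w : ℤ} (hu : u ∈ B)
    (hmem : T - w ∈ moveBead B u w) (h : w < u) : T - u ∉ moveBead B u w := by
  rintro (⟨h1, -⟩ | h1)
  · exact hB _ h1 _ hu (by omega)
  · rcases hmem with ⟨-, h2⟩ | h2 <;> omega

theorem exists_moveBead_of_isOption {m n : ℕ} {Y : YoungDiagram} (hY : MirrorFree (n - m + 1) (beads Y))
    {Z : YoungDiagram} (hZ : IsOption m n Y Z) :
    ∃ u ∈ beads Y, ∃ w ∉ beads Y, w < u ∧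
      (((n : ℤ) - m + 1 - w ∉ moveBead (beads Y) u w ∧ beads Z = moveBead (beads Y) u w) ∨
      ((n : ℤ) - m + 1 - w ∈ moveBead (beads Y) u w ∧
        beads Z = moveBead (moveBead (beads Y) u w) (n - m + 1 - w) (n - m + 1 - u))) := by
  obtain ⟨⟨i, j⟩, hx, hZ⟩ := hZ
  have hlt := (mem_iff_gap_lt_bead Y i j).1 hx
  refine ⟨_, ⟨i, rfl⟩, _, gap_notMem_beads Y j, hlt, ?_⟩
  rw [← beads_removeHook hx]
  rcases hZ with ⟨hno, rfl⟩ | ⟨⟨i', j'⟩, hy, heq, rfl⟩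
  · refine Or.inl ⟨fun hmem => hno ?_, rfl⟩
    have hnot : (n : ℤ) - m + 1 - bead Y i ∉ beads (removeHook Y (i, j)) := by
      rw [beads_removeHook hx] at hmem ⊢
      exact mirror_notMem_moveBead hY ⟨i, rfl⟩ hmem hlt
    obtain ⟨i', j', hy, hu, hw⟩ := exists_hook hmem hnot (by omega)
    refine ⟨(i', j'), hy, ?_⟩
    rw [hookNumbers_eq m n hy, hookNumbers_eq m n hx, hu, hw, map_diagonalNumber_reflect]
  · rw [hookNumbers_eq m n hy, hookNumbers_eq m n hx] at heq
    have hlt' := (mem_iff_gap_lt_bead _ i' j').1 hy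
    rcases eq_or_reflect_of_map_diagonalNumber_eq hlt hlt' heq.symm with ⟨-, h⟩ | ⟨h1, h2⟩
    -- A hook with the same interval would have to end at `u`, which has just been vacated.
    · exfalso
      have hmem : bead (removeHook Y (i, j)) i' ∈ beads (removeHook Y (i, j)) := ⟨i', rfl⟩
      rw [h, beads_removeHook hx] at hmem
      rcases hmem with ⟨-, h⟩ | h <;> omega
    · refine Or.inr ⟨⟨i', h2⟩, ?_⟩
      rw [beads_removeHook hy, h1, h2]

theorem exists_isOption {m n : ℕ} {Y : YoungDiagram} (hY : MirrorFree (n - m + 1) (beads Y))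
    {u w : ℤ} (hu : u ∈ beads Y) (hw : w ∉ beads Y) (h : w < u) :
    ∃ Z, IsOption m n Y Z ∧
      (((n : ℤ) - m + 1 - w ∉ moveBead (beads Y) u w → beads Z = moveBead (beads Y) u w) ∧
      ((n : ℤ) - m + 1 - w ∈ moveBead (beads Y) u w →
        beads Z = moveBead (moveBead (beads Y) u w) (n - m + 1 - w) (n - m + 1 - u))) := by
  obtain ⟨i, j, hx, rfl, rfl⟩ := exists_hook hu hw h
  by_cases hmem : (n : ℤ) - m + 1 - gap Y j ∈ moveBead (beads Y) (bead Y i) (gap Y j)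
  · have hnot := mirror_notMem_moveBead hY hu hmem h
    rw [← beads_removeHook hx] at hmem hnot ⊢
    obtain ⟨i', j', hy, hu', hw'⟩ := exists_hook hmem hnot (by omega)
    refine ⟨removeHook (removeHook Y (i, j)) (i', j'), ⟨(i, j), hx, Or.inr ⟨(i', j'), hy, ?_, rfl⟩⟩,
      fun h => absurd hmem h, fun _ => by rw [beads_removeHook hy, hu', hw']⟩
    rw [hookNumbers_eq m n hy, hookNumbers_eq m n hx, hu', hw', map_diagonalNumber_reflect]
  · refine ⟨removeHook Y (i, j), ⟨(i, j), hx, Or.inl ⟨?_, rfl⟩⟩, fun _ => beads_removeHook hx,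
      fun h => absurd h hmem⟩
    rintro ⟨⟨i', j'⟩, hy, heq⟩
    rw [hookNumbers_eq m n hy, hookNumbers_eq m n hx] at heq
    have hlt' := (mem_iff_gap_lt_bead _ i' j').1 hy
    have hin : bead (removeHook Y (i, j)) i' ∈ beads (removeHook Y (i, j)) := ⟨i', rfl⟩
    rw [beads_removeHook hx] at hin
    rcases eq_or_reflect_of_map_diagonalNumber_eq h hlt' heq.symm with ⟨-, h'⟩ | ⟨-, h'⟩
    · rw [h'] at hin
      rcases hin with ⟨-, h''⟩ | h'' <;> omega
    · exact hmem (h' ▸ hin)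

theorem MirrorFree.of_isOption {m n : ℕ} {Y Z : YoungDiagram}
    (hY : MirrorFree (n - m + 1) (beads Y)) (hZ : IsOption m n Y Z) :
    MirrorFree (n - m + 1) (beads Z) := by
  obtain ⟨u, hu, w, hw, hlt, ⟨hn, h⟩ | ⟨hn, h⟩⟩ := exists_moveBead_of_isOption hY hZ <;> rw [h]
  · rintro x hx y hy hxy
    rcases hx with ⟨hx, hx'⟩ | rfl
    · rcases hy with ⟨hy, hy'⟩ | rfl
      · exact hY x hx y hy hxy
      · exact hn ((eq_sub_of_add_eq hxy) ▸ Or.inl ⟨hx, hx'⟩)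
    · exact hn ((eq_sub_of_add_eq' hxy) ▸ hy)
  · rintro x hx y hy hxy
    rcases hx with ⟨⟨hx, hx'⟩ | rfl, hx''⟩ | rfl
    · rcases hy with ⟨⟨hy, hy'⟩ | rfl, hy''⟩ | rfl
      · exact hY x hx y hy hxy
      · omega
      · omega
    · rcases hy with ⟨⟨hy, hy'⟩ | rfl, hy''⟩ | rfl <;> omega
    · have := hY u hu u hu
      rcases hy with ⟨⟨hy, hy'⟩ | rfl, hy''⟩ | rfl <;> omega

theorem rowLen_rect (m n i : ℕ) : (rect m n).rowLen i = if i < m then n else 0 := by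
  refine rowLen_eq_of_forall fun j => ?_
  rw [← YoungDiagram.mem_cells]
  simp only [rect, Finset.mem_product, Finset.mem_range]
  split_ifs <;> omega

theorem mirrorFree_rect {m n : ℕ} (hmn : m ≤ n) :
    MirrorFree (n - m + 1) (beads (rect m n)) := by
  rintro _ ⟨i, rfl⟩ _ ⟨j, rfl⟩
  unfold bead
  rw [rowLen_rect, rowLen_rect]
  split_ifs <;> omega

theorem mirrorFree_of_mem_positions {m n : ℕ} (hmn : m ≤ n) {Y : YoungDiagram}
    (hY : Y ∈ positions m n) : MirrorFree (n - m + 1) (beads Y) := by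
  induction hY with
  | refl => exact mirrorFree_rect hmn
  | tail _ h ih => exact ih.of_isOption h

theorem IsOption.le {m n : ℕ} {Y Z : YoungDiagram} (h : IsOption m n Y Z) : Z ≤ Y := by
  obtain ⟨x, -, ⟨-, rfl⟩ | ⟨y, -, -, rfl⟩⟩ := h
  · exact removeHook_le Y x
  · exact (removeHook_le _ y).trans (removeHook_le Y x)

theorem IsOption.card_lt {m n : ℕ} {Y Z : YoungDiagram} (h : IsOption m n Y Z) :
    Z.card < Y.card := by
  obtain ⟨x, hx, ⟨-, rfl⟩ | ⟨y, hy, -, rfl⟩⟩ := h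
  · exact removeHook_lt hx
  · exact (removeHook_lt hy).trans (removeHook_lt hx)

/-! ### P-positions and kernels -/

theorem isPPosition_iff {α : Type*} {opt : α → α → Prop} {G : α} :
    IsPPosition opt G ↔ ∀ H, opt G H → ∃ K, opt H K ∧ IsPPosition opt K := by
  constructor
  · rintro ⟨_, reply, legal, win⟩ H h
    exact ⟨reply H h, legal H h, win H h⟩
  · intro h
    choose reply hr using h
    exact ⟨G, reply, fun H h => (hr H h).1, fun H h => (hr H h).2⟩

/-- The P-positions in an option-closed set `S` of positions are the members of a set `P` such that
no option of a member of `P` is in `P` and any other position has an option in `P`. -/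
theorem isPPosition_iff_of_kernel {α : Type*} {opt : α → α → Prop} (size : α → ℕ)
    (hsize : ∀ G H, opt G H → size H < size G) {S P : α → Prop}
    (hS : ∀ G H, S G → opt G H → S H)
    (hP : ∀ G H, S G → P G → opt G H → ¬ P H)
    (hN : ∀ G, S G → ¬ P G → ∃ H, opt G H ∧ P H) {G : α} (hG : S G) :
    IsPPosition opt G ↔ P G := by
  induction hk : size G using Nat.strong_induction_on generalizing G with
  | _ k ih =>
    subst hk
    rw [isPPosition_iff]
    constructor
    · intro h
      by_contra hnP
      obtain ⟨H, hGH, hH⟩ := hN G hG hnP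
      obtain ⟨K, hHK, hK⟩ := h H hGH
      have hSH := hS G H hG hGH
      exact hP H K hSH hH hHK
        ((ih _ ((hsize _ _ hHK).trans (hsize _ _ hGH)) (hS H K hSH hHK) rfl).1 hK)
    · intro h H hGH
      have hSH := hS G H hG hGH
      obtain ⟨K, hHK, hK⟩ := hN H hSH (hP G H hG h hGH)
      exact ⟨K, hHK,
        (ih _ ((hsize _ _ hHK).trans (hsize _ _ hGH)) (hS H K hSH hHK) rfl).2 hK⟩

/-! ### Two rows: the game on pairs -/

/-- The bead set of a partition with at most two parts: the elements `x`, `y` and all integers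
below `-1`. -/
def IsPair (B : Set ℤ) (x y : ℤ) : Prop :=
  -1 ≤ x ∧ -1 ≤ y ∧ x ≠ y ∧ ∀ z, z ∈ B ↔ z = x ∨ z = y ∨ z ≤ -2

theorem IsPair.symm {B : Set ℤ} {x y : ℤ} (h : IsPair B x y) : IsPair B y x :=
  ⟨h.2.1, h.1, h.2.2.1.symm, fun z => by rw [h.2.2.2]; tauto⟩

/-- Moving the element `x` of the pair `x`, `y` to a smaller element, followed by the reflected move
if there is one, turns the pair into `x'`, `y'`. -/
def PairMove (T x y x' y' : ℤ) : Prop :=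
  ∃ w, -1 ≤ w ∧ w < x ∧ w ≠ y ∧
    ((2 * w = T ∧ x' = T - x ∧ y' = y) ∨ (w + y = T ∧ x' = w ∧ y' = T - x) ∨
      (2 * w ≠ T ∧ w + y ≠ T ∧ x' = w ∧ y' = y))

/-- The conditions on a pair expressing that its bead set is mirror free. -/
def PairFree (T x y : ℤ) : Prop :=
  -1 ≤ x ∧ -1 ≤ y ∧ x ≠ y ∧ x ≤ T + 1 ∧ y ≤ T + 1 ∧ x + y ≠ T ∧ 2 * x ≠ T ∧ 2 * y ≠ T

theorem IsPair.pairFree {T : ℤ} {B : Set ℤ} {x y : ℤ} (h : IsPair B x y) (hB : MirrorFree T B) :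
    PairFree T x y := by
  obtain ⟨hx, hy, hne, h⟩ := h
  have hxB := (h x).2 (by omega)
  have hyB := (h y).2 (by omega)
  have h1 := hB x hxB x hxB
  have h2 := hB x hxB y hyB
  have h3 := hB y hyB y hyB
  -- All integers `≤ -2` are beads, so the mirror image of `x` must lie above them.
  have h4 : -2 < T - x := by
    by_contra hc
    exact hB x hxB (T - x) ((h _).2 (by omega)) (by omega)
  have h5 : -2 < T - y := by
    by_contra hc
    exact hB y hyB (T - y) ((h _).2 (by omega)) (by omega)
  refine ⟨hx, hy, hne, ?_⟩
  omega

theorem isPair_of_colLen_le {Y : YoungDiagram} (h : Y.colLen 0 ≤ 2) :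
    IsPair (beads Y) (Y.rowLen 0) (Y.rowLen 1 - 1) := by
  have h10 := Y.rowLen_anti 0 1 (by omega)
  have hz : ∀ i, 2 ≤ i → Y.rowLen i = 0 := fun i hi => by
    by_contra hne
    have := YoungDiagram.mem_iff_lt_colLen.1 (Y.mem_iff_lt_rowLen.2 (Nat.pos_of_ne_zero hne))
    omega
  refine ⟨by omega, by omega, by omega, fun z => ⟨?_, ?_⟩⟩
  · rintro ⟨i, rfl⟩
    unfold bead
    rcases (by omega : i = 0 ∨ i = 1 ∨ 2 ≤ i) with rfl | rfl | hi
    · exact Or.inl (by simp)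
    · exact Or.inr (Or.inl (by simp))
    · rw [hz i hi]
      omega
  · rintro (rfl | rfl | hz')
    · exact ⟨0, by simp [bead]⟩
    · exact ⟨1, by simp [bead]⟩
    · refine ⟨(-z).toNat, ?_⟩
      unfold bead
      rw [hz _ (by omega)]
      omega

theorem colLen_le_of_le {Y Z : YoungDiagram} (h : Z ≤ Y) (j : ℕ) : Z.colLen j ≤ Y.colLen j := by
  by_contra hc
  have := YoungDiagram.mem_iff_lt_colLen.1 (h (Z.mem_iff_lt_colLen.2 (not_le.1 hc)))
  omega

theorem IsPair.moveBead {B : Set ℤ} {x y w : ℤ} (h : IsPair B x y) (hw : -1 ≤ w)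
    (hwy : w ≠ y) : IsPair (moveBead B x w) w y := by
  obtain ⟨hx, hy, hne, h⟩ := h
  refine ⟨hw, hy, hwy, fun z => ?_⟩
  change (z ∈ B ∧ z ≠ x) ∨ z = w ↔ _
  rw [h]
  omega

theorem IsPair.unique {B : Set ℤ} {x y x' y' : ℤ} (h : IsPair B x y) (h' : IsPair B x' y') :
    (x = x' ∧ y = y') ∨ (x = y' ∧ y = x') := by
  obtain ⟨hx, hy, hne, h⟩ := h
  obtain ⟨hx', hy', hne', h'⟩ := h'
  have h1 := (h' x).1 ((h x).2 (by omega))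
  have h2 := (h' y).1 ((h y).2 (by omega))
  omega

theorem IsPair.mirror_mem_moveBead {T : ℤ} {B : Set ℤ} {x y w : ℤ} (h : IsPair B x y)
    (hf : PairFree T x y) (hw : -1 ≤ w) (hwx : w < x) (hwy : w ≠ y) :
    T - w ∈ MHRG.moveBead B x w ↔ 2 * w = T ∨ w + y = T := by
  rw [(h.moveBead hw hwy).2.2.2]
  unfold PairFree at hf
  omega

theorem IsPair.moveBead_reflect {T : ℤ} {B : Set ℤ} {x y w : ℤ} (h : IsPair B x y)
    (hf : PairFree T x y) (hw : -1 ≤ w) (hwx : w < x) (hwy : w ≠ y) :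
    (2 * w = T → IsPair (MHRG.moveBead (MHRG.moveBead B x w) (T - w) (T - x)) (T - x) y) ∧
      (w + y = T → IsPair (MHRG.moveBead (MHRG.moveBead B x w) (T - w) (T - x)) w (T - x)) := by
  have h1 := h.moveBead hw hwy
  unfold PairFree at hf
  constructor
  · intro he
    rw [(by omega : T - w = w)]
    exact h1.moveBead (by omega) (by omega)
  · intro he
    rw [(by omega : T - w = y)]
    exact (h1.symm.moveBead (by omega) (by omega)).symm

theorem IsPair.of_isOption {m n : ℕ} {Y Z : YoungDiagram} {x y : ℤ}
    (hY : MirrorFree (n - m + 1) (beads Y)) (h : IsPair (beads Y) x y) (hZ : IsOption m n Y Z) :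
    ∃ x' y', IsPair (beads Z) x' y' ∧
      (PairMove (n - m + 1) x y x' y' ∨ PairMove (n - m + 1) y x x' y') := by
  obtain ⟨u, hu, w, hw, hlt, hcase⟩ := exists_moveBead_of_isOption hY hZ
  -- There is no gap below a bead `≤ -2`, so the moved bead is one of the pair.
  wlog hux : u = x generalizing x y
  · have hw' := mt (h.2.2.2 w).2 hw
    have huy : u = y := by
      have := (h.2.2.2 u).1 hu
      omega
    obtain ⟨x', y', h', hm⟩ := this h.symm huy
    exact ⟨x', y', h', hm.symm⟩
  subst hux
  have hw' := mt (h.2.2.2 w).2 hw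
  have hf := h.pairFree hY
  have hw1 : -1 ≤ w := by omega
  have hwy : w ≠ y := by omega
  rw [h.mirror_mem_moveBead hf hw1 hlt hwy] at hcase
  rcases hcase with ⟨hno, hb⟩ | ⟨h1 | h1, hb⟩ <;> rw [hb]
  · exact ⟨w, y, h.moveBead hw1 hwy, Or.inl ⟨w, hw1, hlt, hwy, by omega⟩⟩
  · exact ⟨_, _, (h.moveBead_reflect hf hw1 hlt hwy).1 h1,
      Or.inl ⟨w, hw1, hlt, hwy, Or.inl ⟨h1, rfl, rfl⟩⟩⟩
  · exact ⟨_, _, (h.moveBead_reflect hf hw1 hlt hwy).2 h1,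
      Or.inl ⟨w, hw1, hlt, hwy, Or.inr (Or.inl ⟨h1, rfl, rfl⟩)⟩⟩

theorem IsPair.exists_isOption {m n : ℕ} {Y : YoungDiagram} {x y x' y' : ℤ}
    (hY : MirrorFree (n - m + 1) (beads Y)) (h : IsPair (beads Y) x y)
    (hm : PairMove (n - m + 1) x y x' y') :
    ∃ Z, IsOption m n Y Z ∧ IsPair (beads Z) x' y' := by
  obtain ⟨w, hw1, hlt, hwy, hcase⟩ := hm
  have hf := h.pairFree hY
  obtain ⟨Z, hZ, h1, h2⟩ := MHRG.exists_isOption hY ((h.2.2.2 x).2 (Or.inl rfl))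
    (mt (h.2.2.2 w).1 (by omega)) hlt
  rw [h.mirror_mem_moveBead hf hw1 hlt hwy] at h1 h2
  refine ⟨Z, hZ, ?_⟩
  -- In the first case the bead lands on the fixed point `T / 2` and the reflected move carries the
  -- same bead on to `T - x`; in the second it lands on the mirror image of `y`, which then moves.
  rcases hcase with ⟨he, rfl, rfl⟩ | ⟨he, rfl, rfl⟩ | ⟨he, he', rfl, rfl⟩
  · rw [h2 (Or.inl he)]
    exact (h.moveBead_reflect hf hw1 hlt hwy).1 he
  · rw [h2 (Or.inr he)]
    exact (h.moveBead_reflect hf hw1 hlt hwy).2 he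
  · rw [h1 (by omega)]
    exact h.moveBead hw1 hwy

/-- A kernel of the game on pairs, given as a relation between the smaller and the larger
element. -/
def IsPairKernel (T : ℤ) (R : ℤ → ℤ → Prop) : Prop :=
  (∀ x y x' y', PairFree T x y → R x y ∨ R y x → PairMove T x y x' y' → ¬ (R x' y' ∨ R y' x')) ∧
    ∀ x y, PairFree T x y → x < y → ¬ R x y →
      ∃ x' y', (PairMove T x y x' y' ∨ PairMove T y x x' y') ∧ (R x' y' ∨ R y' x')

theorem isPPosition_iff_of_isPairKernel {m n : ℕ} {R : ℤ → ℤ → Prop}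
    (hR : IsPairKernel (n - m + 1) R) (hlt : ∀ x y, R x y → x < y) {Y : YoungDiagram}
    (hY : MirrorFree (n - m + 1) (beads Y)) (hrows : Y.colLen 0 ≤ 2) :
    IsPPosition (IsOption m n) Y ↔ R (Y.rowLen 1 - 1) (Y.rowLen 0) := by
  refine isPPosition_iff_of_kernel YoungDiagram.card (fun _ _ h => h.card_lt)
    (S := fun Y => MirrorFree (n - m + 1) (beads Y) ∧ Y.colLen 0 ≤ 2)
    (P := fun Y => R (Y.rowLen 1 - 1) (Y.rowLen 0))
    (fun G H hG h => ⟨hG.1.of_isOption h, (colLen_le_of_le h.le 0).trans hG.2⟩) ?_ ?_ ⟨hY, hrows⟩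
  · intro G H hG hP h hPH
    have hp := (isPair_of_colLen_le hG.2).symm
    have hq := (isPair_of_colLen_le ((colLen_le_of_le h.le 0).trans hG.2)).symm
    obtain ⟨x', y', h', hm⟩ := hp.of_isOption hG.1 h
    have hR' : R x' y' ∨ R y' x' := by
      rcases hq.unique h' with ⟨rfl, rfl⟩ | ⟨rfl, rfl⟩
      · exact Or.inl hPH
      · exact Or.inr hPH
    rcases hm with hm | hm
    · exact hR.1 _ _ _ _ (hp.pairFree hG.1) (Or.inl hP) hm hR'
    · exact hR.1 _ _ _ _ (hp.symm.pairFree hG.1) (Or.inr hP) hm hR'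
  · intro G hG hP
    have hp := (isPair_of_colLen_le hG.2).symm
    have h10 := G.rowLen_anti 0 1 (by omega)
    obtain ⟨x', y', hm, hR'⟩ := hR.2 _ _ (hp.pairFree hG.1) (by omega) hP
    obtain ⟨Z, hZ, hZp⟩ : ∃ Z, IsOption m n G Z ∧ IsPair (beads Z) x' y' := by
      rcases hm with hm | hm
      · exact hp.exists_isOption hG.1 hm
      · exact hp.symm.exists_isOption hG.1 hm
    have hq := (isPair_of_colLen_le ((colLen_le_of_le hZ.le 0).trans hG.2)).symm
    have h10' := Z.rowLen_anti 0 1 (by omega)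
    refine ⟨Z, hZ, ?_⟩
    rcases hq.unique hZp with ⟨h1, h2⟩ | ⟨h1, h2⟩ <;> rw [h1, h2]
    · exact hR'.resolve_right fun h => by have := hlt _ _ h; omega
    · exact hR'.resolve_left fun h => by have := hlt _ _ h; omega

/-! ### The four kernels -/

/-- The pairs of the partitions `(2 q, 2 q)` with `0 ≤ q ≤ p`. -/
def LowPair (p x y : ℤ) : Prop := y = x + 1 ∧ x % 2 = 1 ∧ -1 ≤ x ∧ x ≤ 2 * p - 1

/-- The pairs `(s + 4 q, s + 4 q + 2)` and `(s + 4 q + 1, s + 4 q + 3)` with elements up to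
`T + 1`. -/
def HighPair (T s x y : ℤ) : Prop :=
  y = x + 2 ∧ s ≤ x ∧ y ≤ T + 1 ∧ ((x - s) % 4 = 0 ∨ (x - s) % 4 = 1)

/-- The exceptional pairs occurring for `n - m = 4 p + 3`. -/
def MiddlePair (p x y : ℤ) : Prop :=
  (x = 2 * p + 1 ∧ y = 2 * p + 4) ∨ (x = 2 * p + 3 ∧ y = 2 * p + 5)

section Moves

variable {T x y w : ℤ} {R : ℤ → ℤ → Prop}

theorem exists_move_larger (hw : -1 ≤ w) (hwy : w < y) (hwx : w ≠ x) (hc : 2 * w ≠ T)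
    (hs : w + x ≠ T) (h : R w x ∨ R x w) :
    ∃ x' y', (PairMove T x y x' y' ∨ PairMove T y x x' y') ∧ (R x' y' ∨ R y' x') :=
  ⟨w, x, Or.inr ⟨w, hw, hwy, hwx, Or.inr (Or.inr ⟨hc, hs, rfl, rfl⟩)⟩, h⟩

theorem exists_move_smaller (hw : -1 ≤ w) (hwx : w < x) (hwy : w ≠ y) (hc : 2 * w ≠ T)
    (hs : w + y ≠ T) (h : R w y ∨ R y w) :
    ∃ x' y', (PairMove T x y x' y' ∨ PairMove T y x x' y') ∧ (R x' y' ∨ R y' x') :=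
  ⟨w, y, Or.inl ⟨w, hw, hwx, hwy, Or.inr (Or.inr ⟨hc, hs, rfl, rfl⟩)⟩, h⟩

/-- Moving `y` to `T - x` forces `x` to `T - y`, which reflects the pair; `T < x + y` makes both
moves go down. -/
theorem exists_move_mirror (hx : x ≤ T + 1) (hxy : T < x + y) (hc : 2 * x ≠ T)
    (h : R (T - y) (T - x)) :
    ∃ x' y', (PairMove T x y x' y' ∨ PairMove T y x x' y') ∧ (R x' y' ∨ R y' x') :=
  ⟨T - x, T - y, Or.inr ⟨T - x, by omega, by omega, by omega,
    Or.inr (Or.inl ⟨by omega, rfl, rfl⟩)⟩, Or.inr h⟩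

end Moves

theorem isPairKernel_zero (p : ℤ) (hp : 0 ≤ p) : IsPairKernel (4 * p + 1)
    fun x y => LowPair p x y ∨ HighPair (4 * p + 1) (2 * p + 1) x y := by
  unfold IsPairKernel PairFree LowPair HighPair
  constructor
  · rintro x y x' y' hf h ⟨w, hw, hwx, hwy, ⟨h1, rfl, rfl⟩ | ⟨h1, rfl, rfl⟩ | ⟨h1, h2, rfl, rfl⟩⟩ h'
    -- `T` is odd, so no bead can land on `T / 2`.
    · omega
    all_goals rcases h with (h | h) | (h | h) <;> rcases h' with (h' | h') | (h' | h') <;> omega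
  · intro x y hf hxy hR
    -- For low `x`, `y` moves to the partner of `x` in the matching `{-1, 0}, {1, 2}, …`.
    rcases le_or_gt x (2 * p) with hlow | hhigh
    · rcases Int.emod_two_eq_zero_or_one x with h2 | h2
      · exact exists_move_larger (w := x - 1) (by omega) (by omega) (by omega) (by omega) (by omega)
          (by omega)
      · exact exists_move_larger (w := x + 1) (by omega) (by omega) (by omega) (by omega) (by omega)
          (by omega)
    -- High elements form blocks of four, in which the first is matched with the third and the
    -- second with the fourth. In the upper half of a block the partner `x - 2` is below `x`.
    · by_cases h4 : 2 ≤ (x - (2 * p + 1)) % 4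
      · exact exists_move_larger (w := x - 2) (by omega) (by omega) (by omega) (by omega) (by omega)
          (by omega)
      -- Here the partner is `x + 2`, out of reach if `y = x + 1`. If `x` starts a block, the
      -- reflected pair is low, as `T - y` is odd; otherwise lowering `x` by one gives the partner
      -- of `y`.
      by_cases hy : y = x + 1
      · by_cases h0 : (x - (2 * p + 1)) % 4 = 0
        · exact exists_move_mirror (by omega) (by omega) (by omega) (by omega)
        · exact exists_move_smaller (w := x - 1) (by omega) (by omega) (by omega) (by omega)
            (by omega) (by omega)
      · exact exists_move_larger (w := x + 2) (by omega) (by omega) (by omega) (by omega) (by omega)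
          (by omega)

/-- Now `T / 2 = 2 * p + 1` cannot be a bead, so the blocks of four start just above it. -/
theorem isPairKernel_one (p : ℤ) (hp : 0 ≤ p) : IsPairKernel (4 * p + 2)
    fun x y => LowPair p x y ∨ HighPair (4 * p + 2) (2 * p + 2) x y := by
  unfold IsPairKernel PairFree LowPair HighPair
  constructor
  · rintro x y x' y' hf h ⟨w, hw, hwx, hwy, ⟨h1, rfl, rfl⟩ | ⟨h1, rfl, rfl⟩ | ⟨h1, h2, rfl, rfl⟩⟩ h'
    all_goals rcases h with (h | h) | (h | h) <;> rcases h' with (h' | h') | (h' | h') <;> omega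
  · intro x y hf hxy hR
    rcases le_or_gt x (2 * p) with hlow | hhigh
    · rcases Int.emod_two_eq_zero_or_one x with h2 | h2
      · exact exists_move_larger (w := x - 1) (by omega) (by omega) (by omega) (by omega) (by omega)
          (by omega)
      · exact exists_move_larger (w := x + 1) (by omega) (by omega) (by omega) (by omega) (by omega)
          (by omega)
    · by_cases h4 : 2 ≤ (x - (2 * p + 2)) % 4
      · exact exists_move_larger (w := x - 2) (by omega) (by omega) (by omega) (by omega) (by omega)
          (by omega)
      by_cases hy : y = x + 1
      · by_cases h0 : (x - (2 * p + 2)) % 4 = 0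
        · exact exists_move_mirror (by omega) (by omega) (by omega) (by omega)
        · exact exists_move_smaller (w := x - 1) (by omega) (by omega) (by omega) (by omega)
            (by omega) (by omega)
      · exact exists_move_larger (w := x + 2) (by omega) (by omega) (by omega) (by omega) (by omega)
          (by omega)

/-- The blocks start at `2 * p + 1`. The adjacent pair `2 * p + 1, 2 * p + 2` has sum `T` and cannot
occur, so reflection is only needed in later blocks. -/
theorem isPairKernel_two (p : ℤ) (hp : 0 ≤ p) : IsPairKernel (4 * p + 3)
    fun x y => LowPair p x y ∨ HighPair (4 * p + 3) (2 * p + 1) x y := by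
  unfold IsPairKernel PairFree LowPair HighPair
  constructor
  · rintro x y x' y' hf h ⟨w, hw, hwx, hwy, ⟨h1, rfl, rfl⟩ | ⟨h1, rfl, rfl⟩ | ⟨h1, h2, rfl, rfl⟩⟩ h'
    · omega
    all_goals rcases h with (h | h) | (h | h) <;> rcases h' with (h' | h') | (h' | h') <;> omega
  · intro x y hf hxy hR
    rcases le_or_gt x (2 * p) with hlow | hhigh
    · rcases Int.emod_two_eq_zero_or_one x with h2 | h2
      · exact exists_move_larger (w := x - 1) (by omega) (by omega) (by omega) (by omega) (by omega)
          (by omega)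
      · exact exists_move_larger (w := x + 1) (by omega) (by omega) (by omega) (by omega) (by omega)
          (by omega)
    · by_cases h4 : 2 ≤ (x - (2 * p + 1)) % 4
      · exact exists_move_larger (w := x - 2) (by omega) (by omega) (by omega) (by omega) (by omega)
          (by omega)
      by_cases hy : y = x + 1
      · by_cases h0 : (x - (2 * p + 1)) % 4 = 0
        · exact exists_move_mirror (by omega) (by omega) (by omega) (by omega)
        · exact exists_move_smaller (w := x - 1) (by omega) (by omega) (by omega) (by omega)
            (by omega) (by omega)
      · exact exists_move_larger (w := x + 2) (by omega) (by omega) (by omega) (by omega) (by omega)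
          (by omega)

-- The fixed point `2 * p + 2` cannot be a bead, and `2 * p + 1`, `2 * p + 3` are mirror images,
-- hence never together. The four admissible elements from `2 * p + 1` to `2 * p + 5` are therefore
-- matched by `MiddlePair`, and the regular blocks start at `2 * p + 6`.
set_option maxHeartbeats 1000000 in
theorem isPairKernel_three (p : ℤ) (hp : 0 ≤ p) : IsPairKernel (4 * p + 4)
    fun x y => LowPair p x y ∨ MiddlePair p x y ∨ HighPair (4 * p + 4) (2 * p + 6) x y := by
  unfold IsPairKernel PairFree LowPair HighPair MiddlePair
  constructor
  · rintro x y x' y' hf h ⟨w, hw, hwx, hwy, ⟨h1, rfl, rfl⟩ | ⟨h1, rfl, rfl⟩ | ⟨h1, h2, rfl, rfl⟩⟩ h'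
    all_goals rcases h with (h | h | h) | (h | h | h) <;>
      rcases h' with (h' | h' | h') | (h' | h' | h') <;> omega
  · intro x y hf hxy hR
    rcases le_or_gt x (2 * p) with hlow | hhigh
    · rcases Int.emod_two_eq_zero_or_one x with h2 | h2
      · exact exists_move_larger (w := x - 1) (by omega) (by omega) (by omega) (by omega) (by omega)
          (by omega)
      · exact exists_move_larger (w := x + 1) (by omega) (by omega) (by omega) (by omega) (by omega)
          (by omega)
    rcases lt_or_ge x (2 * p + 6) with hmid | hhigh'
    · rcases (by omega : x = 2 * p + 1 ∨ x = 2 * p + 3 ∨ x = 2 * p + 4 ∨ x = 2 * p + 5) with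
        rfl | rfl | rfl | rfl
      · exact exists_move_larger (w := 2 * p + 4) (by omega) (by omega) (by omega) (by omega)
          (by omega) (by omega)
      · by_cases hy : y = 2 * p + 4
        · exact exists_move_smaller (w := 2 * p + 1) (by omega) (by omega) (by omega) (by omega)
            (by omega) (by omega)
        · exact exists_move_larger (w := 2 * p + 5) (by omega) (by omega) (by omega) (by omega)
            (by omega) (by omega)
      · exact exists_move_larger (w := 2 * p + 1) (by omega) (by omega) (by omega) (by omega)
          (by omega) (by omega)
      · exact exists_move_larger (w := 2 * p + 3) (by omega) (by omega) (by omega) (by omega)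
          (by omega) (by omega)
    · by_cases h4 : 2 ≤ (x - (2 * p + 6)) % 4
      · exact exists_move_larger (w := x - 2) (by omega) (by omega) (by omega) (by omega) (by omega)
          (by omega)
      by_cases hy : y = x + 1
      · by_cases h0 : (x - (2 * p + 6)) % 4 = 0
        · exact exists_move_mirror (by omega) (by omega) (by omega) (by omega)
        · exact exists_move_smaller (w := x - 1) (by omega) (by omega) (by omega) (by omega)
            (by omega) (by omega)
      · exact exists_move_larger (w := x + 2) (by omega) (by omega) (by omega) (by omega) (by omega)
          (by omega)

/-! ### Translation back to partitions -/

theorem shape_eq_twoRows_iff {Y : YoungDiagram} (h : Y.colLen 0 ≤ 2) (a b : ℤ) :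
    shape Y = twoRows a b ↔ (Y.rowLen 0 : ℤ) = a ∧ (Y.rowLen 1 : ℤ) = b := by
  constructor
  · intro he
    exact ⟨by simpa [shape, twoRows] using congrFun he 0,
      by simpa [shape, twoRows] using congrFun he 1⟩
  · rintro ⟨rfl, rfl⟩
    ext i
    match i with
    | 0 => rfl
    | 1 => rfl
    | i + 2 =>
      have : Y.rowLen (i + 2) = 0 := by
        by_contra hne
        have := YoungDiagram.mem_iff_lt_colLen.1 (Y.mem_iff_lt_rowLen.2 (Nat.pos_of_ne_zero hne))
        omega
      simp [shape, twoRows, this]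

theorem shape_mem_evenPairs_iff {Y : YoungDiagram} (h : Y.colLen 0 ≤ 2) (p : ℕ) :
    shape Y ∈ evenPairs p ↔ LowPair p ((Y.rowLen 1 : ℤ) - 1) (Y.rowLen 0) := by
  simp only [evenPairs, Set.mem_ofPred_eq, shape_eq_twoRows_iff h]
  unfold LowPair
  constructor
  · rintro ⟨q, hq, h1, h2⟩
    omega
  · intro h
    exact ⟨Y.rowLen 1 / 2, by omega, by omega, by omega⟩

/-- The parity term `χ` makes `c - m` the integer part of `(n - m) / 2`. -/
theorem d_eq (m n : ℕ) (i : ℤ) (q : ℕ) : d m n i q = ((n : ℤ) - m) / 2 + 2 + i + 4 * q := by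
  unfold d c chi
  simp only [Nat.even_iff]
  split_ifs <;> omega

end MHRG

open MHRG in
theorem mainTheorem3 (m n : ℕ) (hm : 1 ≤ m) (hmn : m ≤ n)
    (Y : YoungDiagram) (hY : Y ∈ MHRG.positions m n) (hrows : Y.colLen 0 ≤ 2) :
    (∀ p : ℕ, n = m + 4 * p →
      (MHRG.IsPPosition (MHRG.IsOption m n) Y ↔
        MHRG.shape Y ∈ MHRG.evenPairs p ∪
          {s | ∃ q : ℕ, 2 * q + 1 ≤ p ∧
            (s = MHRG.twoRows (MHRG.d m n 1 q) (MHRG.d m n 0 q) ∨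
              s = MHRG.twoRows (MHRG.d m n 2 q) (MHRG.d m n 1 q))})) ∧
    (∀ p : ℕ, n = m + 4 * p + 1 →
      (MHRG.IsPPosition (MHRG.IsOption m n) Y ↔
        MHRG.shape Y ∈ MHRG.evenPairs p ∪
          {s | ∃ q : ℕ, 2 * q + 1 ≤ p ∧
            (s = MHRG.twoRows (MHRG.d m n 2 q) (MHRG.d m n 1 q) ∨
              s = MHRG.twoRows (MHRG.d m n 3 q) (MHRG.d m n 2 q))})) ∧
    (∀ p : ℕ, n = m + 4 * p + 2 →
      (MHRG.IsPPosition (MHRG.IsOption m n) Y ↔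
        MHRG.shape Y ∈ MHRG.evenPairs p ∪
          {s | ∃ q : ℕ, 2 * q ≤ p ∧
            (s = MHRG.twoRows (MHRG.d m n 0 q) (MHRG.d m n (-1) q) ∨
              s = MHRG.twoRows (MHRG.d m n 1 q) (MHRG.d m n 0 q))})) ∧
    (∀ p : ℕ, n = m + 4 * p + 3 →
      (MHRG.IsPPosition (MHRG.IsOption m n) Y ↔
        MHRG.shape Y ∈ MHRG.evenPairs p ∪
          {MHRG.twoRows (2 * p + 4) (2 * p + 2), MHRG.twoRows (2 * p + 5) (2 * p + 4)} ∪
          {s | ∃ q : ℕ, 1 ≤ q ∧ 2 * q ≤ p ∧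
            (s = MHRG.twoRows (MHRG.d m n 1 q) (MHRG.d m n 0 q) ∨
              s = MHRG.twoRows (MHRG.d m n 2 q) (MHRG.d m n 1 q))})) := by

  have hfree := mirrorFree_of_mem_positions hmn hY
  have h10 := Y.rowLen_anti 0 1 (by omega)
  have hlow : ∀ p x y, LowPair p x y → x < y := fun p x y h => by unfold LowPair at h; omega
  have hhigh : ∀ T s x y, HighPair T s x y → x < y := fun T s x y h => by
    unfold HighPair at h; omega
  have hmiddle : ∀ p x y, MiddlePair p x y → x < y := fun p x y h => by
    unfold MiddlePair at h; omega
  refine ⟨?_, ?_, ?_, ?_⟩ <;> rintro p rfl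
  · rw [isPPosition_iff_of_isPairKernel ((by push_cast; ring :
      ((m + 4 * p : ℕ) : ℤ) - m + 1 = 4 * p + 1) ▸ isPairKernel_zero p (by omega))
      (fun x y h => h.elim (hlow _ x y) (hhigh _ _ x y)) hfree hrows]
    rw [Set.mem_union, shape_mem_evenPairs_iff hrows]
    refine or_congr Iff.rfl ?_
    simp only [Set.mem_ofPred_eq, shape_eq_twoRows_iff hrows, d_eq]
    unfold HighPair
    constructor
    · intro h
      -- The index of the block of four: the second part exceeds `2 * p + 2` by `4 * q` or `4 * q +
      -- 1`. The bound on `q` comes from `y ≤ T + 1`.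
      exact ⟨((Y.rowLen 1 - (2 * p + 2)) / 4), by omega, by omega⟩
    · rintro ⟨q, hq, h⟩
      omega
  · rw [isPPosition_iff_of_isPairKernel ((by push_cast; ring :
      ((m + 4 * p + 1 : ℕ) : ℤ) - m + 1 = 4 * p + 2) ▸ isPairKernel_one p (by omega))
      (fun x y h => h.elim (hlow _ x y) (hhigh _ _ x y)) hfree hrows]
    rw [Set.mem_union, shape_mem_evenPairs_iff hrows]
    refine or_congr Iff.rfl ?_
    simp only [Set.mem_ofPred_eq, shape_eq_twoRows_iff hrows, d_eq]
    unfold HighPair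
    constructor
    · intro h
      exact ⟨((Y.rowLen 1 - (2 * p + 3)) / 4), by omega, by omega⟩
    · rintro ⟨q, hq, h⟩
      omega
  · rw [isPPosition_iff_of_isPairKernel ((by push_cast; ring :
      ((m + 4 * p + 2 : ℕ) : ℤ) - m + 1 = 4 * p + 3) ▸ isPairKernel_two p (by omega))
      (fun x y h => h.elim (hlow _ x y) (hhigh _ _ x y)) hfree hrows]
    rw [Set.mem_union, shape_mem_evenPairs_iff hrows]
    refine or_congr Iff.rfl ?_
    simp only [Set.mem_ofPred_eq, shape_eq_twoRows_iff hrows, d_eq]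
    unfold HighPair
    constructor
    · intro h
      exact ⟨((Y.rowLen 1 - (2 * p + 2)) / 4), by omega, by omega⟩
    · rintro ⟨q, hq, h⟩
      omega
  · rw [isPPosition_iff_of_isPairKernel ((by push_cast; ring :
      ((m + 4 * p + 3 : ℕ) : ℤ) - m + 1 = 4 * p + 4) ▸ isPairKernel_three p (by omega))
      (fun x y h => h.elim (hlow _ x y) fun h => h.elim (hmiddle _ x y) (hhigh _ _ x y))
      hfree hrows]
    rw [Set.mem_union, Set.mem_union, shape_mem_evenPairs_iff hrows, or_assoc]
    refine or_congr Iff.rfl (or_congr ?_ ?_)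
    · simp only [Set.mem_insert_iff, Set.mem_singleton_iff, shape_eq_twoRows_iff hrows]
      unfold MiddlePair
      omega
    simp only [Set.mem_ofPred_eq, shape_eq_twoRows_iff hrows, d_eq]
    unfold HighPair
    constructor
    · intro h
      -- The first block has second part `2 * p + 7 = d_0(1)`, which is why `q` starts at `1`.
      exact ⟨((Y.rowLen 1 - (2 * p + 3)) / 4), by omega, by omega, by omega⟩
    · rintro ⟨q, hq, hq', h⟩
      omega
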